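/- Setting. Let $U=\{1,\dots,n\}$, let $p_e\in[0,1]$ for $e\in U$, and let $\log$ denote the logarithm to base $2$. A decision tree $\mathcal T$ over $U$ is a finite rooted binary tree in which every internal node $v$ represents an element $\mathsf{elt}(v)\in U$ and has two outgoing arcs, labelled Yes and No, such that no element is represented by two different nodes on the same root-to-leaf path; leaves represent no element. For a set $V$ of internal nodes put $\mathsf{elt}(V)=\{\mathsf{elt}(v):v\in V\}$. For a leaf $\ell$ let $P_\ell$ be the set of internal nodes on the path from the root to $\ell$, and let $A_\ell\subseteq P_\ell$ be the set of those nodes on this path from which the Yes arc is taken (the active ancestors of $\ell$). Let $\pi_{\mathcal T}$ be the distribution of the leaf that is reached from the root by following, at each internal node $v$, the Yes arc with probability $p_{\mathsf{elt}(v)}$ and the No arc with probability $1-p_{\mathsf{elt}(v)}$, independently. Let $\mathbb P_R$ be the distribution of the random set $R$ of nodes obtained as follows: independently for each element $e\in U$, with probability $p_e$ all nodes representing $e$ belong to $R$, and otherwise none of them does. The non-adaptive strategy AlgPath samples $\ell\leftarrow\pi_{\mathcal T}$ and, independently, $R\sim\mathbb P_R$, probes all elements of $\mathsf{elt}(P_\ell)$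 and collects the active elements $\mathsf{elt}(R\cap P_\ell)$; its expected reward for an objective $f:2^U\to\mathbb R_{\ge 0}$ is $\mathbb E_{\ell\leftarrow\pi_{\mathcal T}}\big[\mathbb E_{R\sim\mathbb P_R}[f(\mathsf{elt}(R\cap P_\ell))]\big]$. Theorem. Let $n\ge 100$, let $\mathcal T$ be a decision tree over $U$, and let $A'_\ell\subseteq A_\ell$ be a subset for each leaf $\ell$ of $\mathcal T$. Put $$f_{\mathrm{xos}}(S)=\max_{\ell}\,|\mathsf{elt}(A'_\ell)\cap S|\qquad(S\subseteq U),$$ where the maximum is over all leaves $\ell$ of $\mathcal T$. If $$\mathbb E_{\ell\leftarrow\pi_{\mathcal T}}\big[|A'_\ell|\big]\ \ge\ 200\log n,$$ then $$\mathbb E_{\ell\leftarrow\pi_{\mathcal T}}\Big[\mathbb E_{R\sim\mathbb P_R}\big[f_{\mathrm{xos}}(\mathsf{elt}(R\cap P_\ell))\big]\Big]\ \ge\ \frac{1}{200\log n}\,\mathbb E_{\ell\leftarrow\pi_{\mathcal T}}\big[|A'_\ell|\big].$$ -/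

import Mathlib

/-- Finite binary decision trees over a ground set `U`. A leaf ends the probing process; an internal
node `node e y n` probes the element `e` and continues in `y` along its Yes arc (if `e` is active)
and in `n` along its No arc (otherwise). -/
inductive DecTree (U : Type) : Type where
  | leaf : DecTree U
  | node (e : U) (yes no : DecTree U) : DecTree U

namespace DecTree

variable {U : Type}

/-- The leaves of a decision tree. -/
inductive Leaf : DecTree U → Type where
  | here : Leaf leaf
  | yes {e : U} {y n : DecTree U} (l : Leaf y) : Leaf (node e y n)
  | no {e : U} {y n : DecTree U} (l : Leaf n) : Leaf (node e y n)

/-- The internal nodes of a decision tree: its root (if the tree is not a leaf), and the internal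
nodes of its two subtrees. Different nodes may represent the same element. -/
inductive Node : DecTree U → Type where
  | root {e : U} {y n : DecTree U} : Node (node e y n)
  | yes {e : U} {y n : DecTree U} (v : Node y) : Node (node e y n)
  | no {e : U} {y n : DecTree U} (v : Node n) : Node (node e y n)

/-- The leaves of a tree that is not a leaf are those of its two subtrees. -/
def leafEquiv (e : U) (y n : DecTree U) : Leaf y ⊕ Leaf n ≃ Leaf (node e y n) where
  toFun x := match x with
    | Sum.inl l => Leaf.yes l
    | Sum.inr l => Leaf.no l
  invFun x := match x with
    | Leaf.yes l => Sum.inl l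
    | Leaf.no l => Sum.inr l
  left_inv x := by cases x <;> rfl
  right_inv x := by cases x <;> rfl

/-- The internal nodes of a tree that is not a leaf are its root and those of its two subtrees. -/
def nodeEquiv (e : U) (y n : DecTree U) : Option (Node y ⊕ Node n) ≃ Node (node e y n) where
  toFun x := match x with
    | none => Node.root
    | some (Sum.inl v) => Node.yes v
    | some (Sum.inr v) => Node.no v
  invFun x := match x with
    | Node.root => none
    | Node.yes v => some (Sum.inl v)
    | Node.no v => some (Sum.inr v)
  left_inv x := by rcases x with _ | _ | _ <;> rfl
  right_inv x := by cases x <;> rfl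

instance instFintypeLeaf : (T : DecTree U) → Fintype T.Leaf
  | leaf => ⟨{Leaf.here}, fun l => by cases l; simp⟩
  | node e y n =>
    letI := instFintypeLeaf y
    letI := instFintypeLeaf n
    Fintype.ofEquiv _ (leafEquiv e y n)

instance instFintypeNode : (T : DecTree U) → Fintype T.Node
  | leaf => ⟨∅, fun v => nomatch v⟩
  | node e y n =>
    letI := instFintypeNode y
    letI := instFintypeNode n
    Fintype.ofEquiv _ (nodeEquiv e y n)

instance instDecidableEqNode : (T : DecTree U) → DecidableEq T.Node
  | leaf => fun v => nomatch v
  | node e y n =>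
    letI := instDecidableEqNode y
    letI := instDecidableEqNode n
    (nodeEquiv e y n).symm.decidableEq

/-- The element represented by an internal node. -/
def elt : (T : DecTree U) → T.Node → U
  | node e _ _, Node.root => e
  | node _ y _, Node.yes v => y.elt v
  | node _ _ n, Node.no v => n.elt v

/-- Nodes of the Yes subtree, as nodes of the whole tree. -/
def yesNode (e : U) (y n : DecTree U) : y.Node ↪ (node e y n).Node where
  toFun := Node.yes
  inj' _ _ h := by cases h; rfl

/-- Nodes of the No subtree, as nodes of the whole tree. -/
def noNode (e : U) (y n : DecTree U) : n.Node ↪ (node e y n).Node where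
  toFun := Node.no
  inj' _ _ h := by cases h; rfl

/-- `T.path ℓ` is the set `P_ℓ` of all internal nodes on the path from the root to the leaf `ℓ`. -/
def path : (T : DecTree U) → T.Leaf → Finset T.Node
  | leaf, Leaf.here => ∅
  | node e y n, Leaf.yes l => insert Node.root ((y.path l).map (yesNode e y n))
  | node e y n, Leaf.no l => insert Node.root ((n.path l).map (noNode e y n))

/-- `T.active ℓ` is the set `A_ℓ` of active ancestors of the leaf `ℓ`: the nodes on the path from
the root to `ℓ` whose Yes arc is taken. -/
def active : (T : DecTree U) → T.Leaf → Finset T.Node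
  | leaf, Leaf.here => ∅
  | node e y n, Leaf.yes l => insert Node.root ((y.active l).map (yesNode e y n))
  | node e y n, Leaf.no l => (n.active l).map (noNode e y n)

/-- No element is represented by more than one node on any root-to-leaf path. -/
def Distinct (T : DecTree U) : Prop :=
  ∀ l : T.Leaf, Set.InjOn T.elt (T.path l)

/-- The probability `π_T(ℓ)` of reaching the leaf `ℓ` when at every node `v` the Yes arc is followed
with probability `p (elt v)` and the No arc otherwise. -/
def leafProb (p : U → ℝ) : (T : DecTree U) → T.Leaf → ℝ
  | leaf, Leaf.here => 1
  | node e y _, Leaf.yes l => p e * y.leafProb p l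
  | node e _ n, Leaf.no l => (1 - p e) * n.leafProb p l

/-- Expectation over a random leaf `ℓ ← π_T`. -/
def expLeaf (p : U → ℝ) (T : DecTree U) (g : T.Leaf → ℝ) : ℝ :=
  ∑ l : T.Leaf, T.leafProb p l * g l

variable [Fintype U] [DecidableEq U]

/-- The probability that `S` is exactly the set of active elements, when each element `e` is active
independently with probability `p e`. -/
def activeProb (p : U → ℝ) (S : Finset U) : ℝ :=
  (∏ e ∈ S, p e) * ∏ e ∈ Sᶜ, (1 - p e)

/-- The set of all nodes whose element lies in `S`. -/
def nodesOf (T : DecTree U) (S : Finset U) : Finset T.Node :=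
  Finset.univ.filter fun v => T.elt v ∈ S

/-- Expectation over the random node set `R ∼ P_R`: for each element `e`, independently with
probability `p e`, all nodes representing `e` are put into `R`. -/
def expR (p : U → ℝ) (T : DecTree U) (g : Finset T.Node → ℝ) : ℝ :=
  ∑ S : Finset U, activeProb p S * g (T.nodesOf S)

/-- The set of elements represented by a set of nodes. -/
def eltSet (T : DecTree U) (V : Finset T.Node) : Finset U := V.image T.elt

/-- The expected reward of the non-adaptive strategy AlgPath derived from `T`, for the objective
`f`: sample a leaf `ℓ ← π_T`, probe all elements on its path with fresh independent realizations,
and collect the active ones. -/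
def nadp (p : U → ℝ) (T : DecTree U) (f : Finset U → ℝ) : ℝ :=
  T.expLeaf p fun l => T.expR p fun R => f (T.eltSet (R ∩ T.path l))

/-- `f_xos(S) = max_ℓ |elt(A'_ℓ) ∩ S|`, for a family `A'` of node sets indexed by the leaves. -/
def fxos (T : DecTree U) (A' : T.Leaf → Finset T.Node) (S : Finset U) : ℕ :=
  Finset.univ.sup fun l : T.Leaf => (T.eltSet (A' l) ∩ S).card

end DecTree

/-! Write `L` for the base-2 logarithm of `n`, `f` for `fxos`, and call a leaf bad if fresh
realizations on its path earn at most `|A' l| / (100 * L)`. The other leaves satisfy `|A' l| < 100 *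
L * pathReward`, so it suffices that bad leaves carry little of the expected size of `A'`. By
`card_le_of_dyadic`, the bad leaves of one dyadic size class carry at most 9. There are at most `L +
1` classes, so all of them carry at most `18 * L`, well below half of the expectation.

For one class, retain each element of `A' l` with probability `δ = 1 / (4 * L)` and call the result
`J`. Then `f J ≥ |J|`, whereas on a fresh sample `f` is concentrated around a small mean: `E exp (f
/ 2) ≤ exp (E f)` by `expSet_exp_sup_le`. The difficulty is that `J` comes from the adaptive run,
where leaf and realization are dependent. The decoupling inequality `sum_thinned_mul_log_le`, with
test function `exp (f / 2 - τ)`, bounds `E (|J| / 2 - τ)` by `δ` times the entropy of `J`. It is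
proved by induction on the tree: an active element shows up in `J` only with probability `δ`, so its
correlation with the leaf costs a `δ`-fraction of the entropy created by mixing the two branches. By
`entropy_le` the entropy of `J` is about `E |J| * log n`, and `δ * log n = (log 2) / 4 < 1 / 2`, so
the left side wins unless the class carries only a constant. -/

namespace DecTree

/-! ### Product measures on subsets and an exponential moment bound. -/

section FreshSet

variable {U : Type} [Fintype U] [DecidableEq U]

/-- Expectation over a random set that contains each `e` independently with probability `p e`. -/
def expSet (p : U → ℝ) (φ : Finset U → ℝ) : ℝ :=
  ∑ S : Finset U, activeProb p S * φ S

lemma activeProb_nonneg {p : U → ℝ} (hp : ∀ e, p e ∈ Set.Icc (0 : ℝ) 1) (S : Finset U) :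
    0 ≤ activeProb p S :=
  mul_nonneg (Finset.prod_nonneg fun e _ => (hp e).1)
    (Finset.prod_nonneg fun e _ => sub_nonneg.2 (hp e).2)

lemma sum_activeProb (p : U → ℝ) : ∑ S : Finset U, activeProb p S = 1 := by
  have h := Finset.prod_add p (fun e => 1 - p e) Finset.univ
  simp only [add_sub_cancel, Finset.prod_const_one, Finset.powerset_univ] at h
  rw [h]
  exact Finset.sum_congr rfl fun S _ => by rw [activeProb, Finset.compl_eq_univ_sdiff]

lemma expSet_const (p : U → ℝ) (c : ℝ) : expSet p (fun _ => c) = c := by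
  rw [expSet, ← Finset.sum_mul, sum_activeProb, one_mul]

lemma expSet_mono {p : U → ℝ} (hp : ∀ e, p e ∈ Set.Icc (0 : ℝ) 1) {φ ψ : Finset U → ℝ}
    (h : ∀ S, φ S ≤ ψ S) : expSet p φ ≤ expSet p ψ :=
  Finset.sum_le_sum fun S _ => mul_le_mul_of_nonneg_left (h S) (activeProb_nonneg hp S)

lemma expSet_nonneg {p : U → ℝ} (hp : ∀ e, p e ∈ Set.Icc (0 : ℝ) 1) {φ : Finset U → ℝ}
    (h : ∀ S, 0 ≤ φ S) : 0 ≤ expSet p φ :=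
  Finset.sum_nonneg fun S _ => mul_nonneg (activeProb_nonneg hp S) (h S)

lemma expSet_add (p : U → ℝ) (φ ψ : Finset U → ℝ) :
    expSet p (fun S => φ S + ψ S) = expSet p φ + expSet p ψ := by
  simp only [expSet, mul_add, Finset.sum_add_distrib]

lemma expSet_const_mul (p : U → ℝ) (c : ℝ) (φ : Finset U → ℝ) :
    expSet p (fun S => c * φ S) = c * expSet p φ := by
  simp only [expSet, Finset.mul_sum]
  exact Finset.sum_congr rfl fun S _ => by ring

lemma sum_finset_eq_sum_erase (e : U) (φ : Finset U → ℝ) :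
    ∑ S : Finset U, φ S =
      ∑ S ∈ (Finset.univ.erase e).powerset, (φ S + φ (insert e S)) := by
  rw [← Finset.powerset_univ, ← Finset.insert_erase (Finset.mem_univ e),
    Finset.sum_powerset_insert (Finset.notMem_erase e _), Finset.sum_add_distrib]
  simp

lemma activeProb_insert (p : U → ℝ) {e : U} {S : Finset U} (he : e ∉ S) :
    activeProb p (insert e S) = p e * ((∏ i ∈ S, p i) * ∏ i ∈ Sᶜ.erase e, (1 - p i)) := by
  rw [activeProb, Finset.prod_insert he, Finset.compl_insert, mul_assoc]

lemma activeProb_of_notMem (p : U → ℝ) {e : U} {S : Finset U} (he : e ∉ S) :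
    activeProb p S = (1 - p e) * ((∏ i ∈ S, p i) * ∏ i ∈ Sᶜ.erase e, (1 - p i)) := by
  rw [activeProb, ← Finset.mul_prod_erase Sᶜ (fun i => 1 - p i) (Finset.mem_compl.2 he)]
  ring

/-- Conditioning on whether the element `e` belongs to the random set. -/
lemma expSet_cond (p : U → ℝ) (e : U) (φ : Finset U → ℝ) :
    expSet p φ =
      (1 - p e) * expSet p (fun S => φ (S.erase e)) + p e * expSet p (fun S => φ (insert e S)) := by
  simp only [expSet, sum_finset_eq_sum_erase e, Finset.mul_sum, ← Finset.sum_add_distrib]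
  refine Finset.sum_congr rfl fun S hS => ?_
  have he : e ∉ S := fun h => Finset.notMem_erase e _ (Finset.mem_powerset.1 hS h)
  rw [activeProb_insert p he, activeProb_of_notMem p he, Finset.erase_insert he,
    Finset.erase_eq_of_notMem he, Finset.insert_idem]
  ring

lemma expSet_inter_insert (p : U → ℝ) {e : U} {P : Finset U} (he : e ∉ P) (φ : Finset U → ℝ) :
    expSet p (fun S => φ (S ∩ insert e P)) =
      (1 - p e) * expSet p (fun S => φ (S ∩ P)) +
        p e * expSet p (fun S => φ (insert e (S ∩ P))) := by
  rw [expSet_cond p e]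
  congr 4
  · funext S
    congr 1
    grind
  · funext S
    congr 1
    grind

lemma expSet_card_inter {δ : ℝ} (B : Finset U) :
    expSet (fun _ => δ) (fun S => ((S ∩ B).card : ℝ)) = δ * B.card := by
  induction B using Finset.induction_on with
  | empty => simp [expSet_const]
  | insert e B he ih =>
    rw [expSet_inter_insert _ he (fun S => (S.card : ℝ)), ih]
    have h : (fun S : Finset U => ((insert e (S ∩ B)).card : ℝ)) =
        fun S => ((S ∩ B).card : ℝ) + 1 := by
      funext S
      rw [Finset.card_insert_of_notMem (by grind)]
      push_cast
      ring
    rw [h, expSet_add, ih, expSet_const, Finset.card_insert_of_notMem he]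
    push_cast
    ring

/-- Follows from `log (1 + d) ≥ 2 * d / (d + 2)`, since `(d - d ^ 2 / 2) * (d + 2) = 2 * d - d ^ 3 /
2`. -/
lemma exp_sub_sq_half_le {d : ℝ} (h : 0 ≤ d) : Real.exp (d - d ^ 2 / 2) ≤ 1 + d := by
  rw [← Real.le_log_iff_exp_le (by linarith)]
  refine le_trans ?_ (Real.le_log_one_add_of_nonneg h)
  rw [le_div_iff₀ (by linarith)]
  nlinarith [pow_nonneg h 3]

/-- Exponential moment of a maximum of coverage functions of a random set. -/
theorem expSet_exp_sup_le {ι : Type*} [Fintype ι] [Nonempty ι] {p : U → ℝ}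
    (hp : ∀ e, p e ∈ Set.Icc (0 : ℝ) 1) (B : ι → Finset U) (P : Finset U) (c : ι → ℝ) :
    expSet p (fun S => Real.exp (Finset.univ.sup' Finset.univ_nonempty
        fun i => c i + (B i ∩ (S ∩ P)).card / 2)) ≤
      Real.exp (expSet p fun S => Finset.univ.sup' Finset.univ_nonempty
        fun i => c i + ((B i ∩ (S ∩ P)).card : ℝ)) := by
  -- Revealing one element turns its contribution into a shift of the offsets, so these must stay
  -- free in the induction.
  induction P using Finset.induction_on generalizing c with
  | empty => simp [expSet_const]
  | insert e P he ih =>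
    set b : ι → ℝ := fun i => if e ∈ B i then 1 else 0 with hb
    have hb0 : ∀ i, 0 ≤ b i := fun i => by simp only [hb]; split_ifs <;> norm_num
    have hb1 : ∀ i, b i ≤ 1 := fun i => by simp only [hb]; split_ifs <;> norm_num
    have hbb : ∀ i, b i * b i ≤ b i := fun i => by
      simp only [hb]; split_ifs <;> norm_num
    have hcard : ∀ i (S : Finset U), ((B i ∩ insert e (S ∩ P)).card : ℝ) =
        b i + ((B i ∩ (S ∩ P)).card : ℝ) := by
      intro i S
      by_cases hi : e ∈ B i
      · rw [Finset.inter_insert_of_mem hi, Finset.card_insert_of_notMem (by grind)]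
        simp only [hb, if_pos hi]; push_cast; ring
      · rw [Finset.inter_insert_of_notMem hi]
        simp only [hb, if_neg hi]; ring
    set H : (ι → ℝ) → Finset U → ℝ := fun c S => Finset.univ.sup' Finset.univ_nonempty
        fun i => c i + ((B i ∩ (S ∩ P)).card : ℝ) with hH
    set a₀ := expSet p (H c) with ha₀
    set a₁ := expSet p (H fun i => c i + b i) with ha₁
    have h01 : a₀ ≤ a₁ := expSet_mono hp fun S =>
      Finset.sup'_mono_fun fun i _ => by linarith [hb0 i]
    have h10 : a₁ ≤ a₀ + 1 := by
      rw [ha₀, ← expSet_const p 1, ← expSet_add]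
      refine expSet_mono hp fun S => Finset.sup'_le _ _ fun i hi => ?_
      have := Finset.le_sup' (fun i => c i + ((B i ∩ (S ∩ P)).card : ℝ)) hi
      simp only [hH]
      linarith [hb1 i]
    set d := a₁ - a₀ with hd
    have hyes : expSet p (fun S => Real.exp (Finset.univ.sup' Finset.univ_nonempty
        fun i => c i + (B i ∩ insert e (S ∩ P)).card / 2)) ≤
        Real.exp a₀ * Real.exp (d - d ^ 2 / 2) := by
      -- The supremum is convex in the offsets. With offset `(1 - d) * b` in place of `b` the mean
      -- drops to `a₀ + d - d ^ 2`; replacing `b / 2` by it costs at most `d ^ 2 / 2`. The net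
      -- exponent `a₀ + d - d ^ 2 / 2` is small enough for the factor `1 + d`.
      have h1 : expSet p (H fun i => c i + (1 - d) * b i) ≤ (1 - d) * a₁ + d * a₀ := by
        rw [ha₁, ha₀, ← expSet_const_mul, ← expSet_const_mul, ← expSet_add]
        refine expSet_mono hp fun S => Finset.sup'_le _ _ fun i hi => ?_
        have e1 := Finset.le_sup' (fun i => c i + ((B i ∩ (S ∩ P)).card : ℝ)) hi
        have e2 := Finset.le_sup' (fun i => c i + b i + ((B i ∩ (S ∩ P)).card : ℝ)) hi
        simp only [hH] at *
        nlinarith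
      have h2 := ih fun i => c i + (1 - d) * b i
      calc _ ≤ expSet p (fun S => Real.exp (d ^ 2 / 2) *
              Real.exp (Finset.univ.sup' Finset.univ_nonempty
              fun i => c i + (1 - d) * b i + (B i ∩ (S ∩ P)).card / 2)) := by
            refine expSet_mono hp fun S => ?_
            rw [← Real.exp_add]
            refine Real.exp_le_exp.2 (Finset.sup'_le _ _ fun i hi => ?_)
            have e1 := Finset.le_sup'
              (fun i => c i + (1 - d) * b i + ((B i ∩ (S ∩ P)).card : ℝ) / 2) hi
            rw [hcard]
            -- Needed: `b / 2 ≤ d ^ 2 / 2 + (1 - d) * b`. As `b * b ≤ b`, this follows from `(d - b)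
            -- ^ 2 ≥ 0`.
            nlinarith [sq_nonneg (d - b i), hbb i]
        _ ≤ Real.exp (d ^ 2 / 2) * Real.exp ((1 - d) * a₁ + d * a₀) := by
            rw [expSet_const_mul]
            exact mul_le_mul_of_nonneg_left (h2.trans (Real.exp_le_exp.2 h1)) (Real.exp_pos _).le
        _ = _ := by
            rw [← Real.exp_add, ← Real.exp_add]
            congr 1
            simp only [hd]; ring
    rw [expSet_inter_insert p he (fun S => Real.exp (Finset.univ.sup' Finset.univ_nonempty
        fun i => c i + (B i ∩ S).card / 2)),
      expSet_inter_insert p he (fun S => Finset.univ.sup' Finset.univ_nonempty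
        fun i => c i + ((B i ∩ S).card : ℝ))]
    have hr : (fun S : Finset U => Finset.univ.sup' Finset.univ_nonempty
        fun i => c i + ((B i ∩ insert e (S ∩ P)).card : ℝ)) = H fun i => c i + b i := by
      funext S
      simp only [hH, hcard, add_assoc]
    rw [hr]
    change _ ≤ Real.exp ((1 - p e) * a₀ + p e * a₁)
    have hsplit : (1 - p e) * a₀ + p e * a₁ = a₀ + p e * d := by simp only [hd]; ring
    rw [hsplit, Real.exp_add]
    have hno := ih c
    change _ ≤ Real.exp a₀ at hno
    have hd0 : 0 ≤ d := sub_nonneg.2 h01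
    have k1 := exp_sub_sq_half_le hd0
    have k2 := Real.add_one_le_exp (p e * d)
    have hE := Real.exp_pos a₀
    have q0 := (hp e).1
    have q1 : 0 ≤ 1 - p e := sub_nonneg.2 (hp e).2
    calc _ ≤ (1 - p e) * Real.exp a₀ + p e * (Real.exp a₀ * (1 + d)) := by
          gcongr
          exact hyes.trans (by gcongr)
      _ = Real.exp a₀ * (p e * d + 1) := by ring
      _ ≤ _ := by gcongr

end FreshSet

/-! ### Expectations over leaves, and recursion of paths at the root. -/

section Tree

variable {U : Type}

lemma expLeaf_leaf (p : U → ℝ) (g : (leaf : DecTree U).Leaf → ℝ) :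
    expLeaf p leaf g = g Leaf.here := by
  have : (Finset.univ : Finset (leaf : DecTree U).Leaf) = {Leaf.here} := rfl
  simp [expLeaf, this, leafProb]

lemma expLeaf_node (p : U → ℝ) (e : U) (y n : DecTree U) (g : (node e y n).Leaf → ℝ) :
    expLeaf p (node e y n) g =
      p e * expLeaf p y (fun l => g (Leaf.yes l)) +
        (1 - p e) * expLeaf p n (fun l => g (Leaf.no l)) := by
  rw [expLeaf, ← (leafEquiv e y n).sum_comp, Fintype.sum_sum_type]
  simp only [expLeaf, Finset.mul_sum, leafEquiv, Equiv.coe_fn_mk, leafProb, mul_assoc]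

lemma leafProb_nonneg {p : U → ℝ} (hp : ∀ e, p e ∈ Set.Icc (0 : ℝ) 1) :
    (T : DecTree U) → (l : T.Leaf) → 0 ≤ T.leafProb p l
  | leaf, Leaf.here => zero_le_one
  | node e y _, Leaf.yes l => mul_nonneg (hp e).1 (leafProb_nonneg hp y l)
  | node e _ n, Leaf.no l => mul_nonneg (sub_nonneg.2 (hp e).2) (leafProb_nonneg hp n l)

lemma expLeaf_mono {p : U → ℝ} (hp : ∀ e, p e ∈ Set.Icc (0 : ℝ) 1) {T : DecTree U}
    {g h : T.Leaf → ℝ} (hgh : ∀ l, g l ≤ h l) : T.expLeaf p g ≤ T.expLeaf p h :=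
  Finset.sum_le_sum fun l _ => mul_le_mul_of_nonneg_left (hgh l) (leafProb_nonneg hp T l)

lemma expLeaf_nonneg {p : U → ℝ} (hp : ∀ e, p e ∈ Set.Icc (0 : ℝ) 1) {T : DecTree U}
    {g : T.Leaf → ℝ} (hg : ∀ l, 0 ≤ g l) : 0 ≤ T.expLeaf p g :=
  Finset.sum_nonneg fun l _ => mul_nonneg (leafProb_nonneg hp T l) (hg l)

lemma expLeaf_add (p : U → ℝ) (T : DecTree U) (g h : T.Leaf → ℝ) :
    T.expLeaf p (fun l => g l + h l) = T.expLeaf p g + T.expLeaf p h := by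
  simp only [expLeaf, mul_add, Finset.sum_add_distrib]

lemma expLeaf_const_mul (p : U → ℝ) (T : DecTree U) (c : ℝ) (g : T.Leaf → ℝ) :
    T.expLeaf p (fun l => c * g l) = c * T.expLeaf p g := by
  simp only [expLeaf, Finset.mul_sum]
  exact Finset.sum_congr rfl fun S _ => by ring

lemma expLeaf_zero (p : U → ℝ) (T : DecTree U) : T.expLeaf p (fun _ => 0) = 0 := by
  simp [expLeaf]

lemma expLeaf_sum {ι : Type*} (s : Finset ι) (p : U → ℝ) (T : DecTree U) (g : ι → T.Leaf → ℝ) :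
    T.expLeaf p (fun l => ∑ i ∈ s, g i l) = ∑ i ∈ s, T.expLeaf p (g i) := by
  simp only [expLeaf, Finset.mul_sum]
  exact Finset.sum_comm

instance instNonemptyLeaf (T : DecTree U) : Nonempty T.Leaf := by
  induction T with
  | leaf => exact ⟨Leaf.here⟩
  | node e y n hy hn => exact hy.map Leaf.yes

lemma active_subset_path (T : DecTree U) (l : T.Leaf) : T.active l ⊆ T.path l := by
  induction l with
  | here => simp [active]
  | yes l ih => exact Finset.insert_subset_insert _ (Finset.map_subset_map.2 ih)
  | no l ih => exact (Finset.map_subset_map.2 ih).trans (Finset.subset_insert _ _)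

lemma Distinct.yes {e : U} {y n : DecTree U} (h : (node e y n).Distinct) : y.Distinct := by
  intro l v hv w hw hvw
  have := @h (Leaf.yes l) (Node.yes v) (Finset.mem_coe.2 (Finset.mem_insert_of_mem (Finset.mem_map_of_mem (yesNode e y n) hv)))
    (Node.yes w) (Finset.mem_coe.2 (Finset.mem_insert_of_mem (Finset.mem_map_of_mem (yesNode e y n) hw))) hvw
  exact (yesNode e y n).injective this

lemma Distinct.no {e : U} {y n : DecTree U} (h : (node e y n).Distinct) : n.Distinct := by
  intro l v hv w hw hvw
  have := @h (Leaf.no l) (Node.no v) (Finset.mem_coe.2 (Finset.mem_insert_of_mem (Finset.mem_map_of_mem (noNode e y n) hv)))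
    (Node.no w) (Finset.mem_coe.2 (Finset.mem_insert_of_mem (Finset.mem_map_of_mem (noNode e y n) hw))) hvw
  exact (noNode e y n).injective this

variable [DecidableEq U]

lemma eltSet_path_yes (e : U) (y n : DecTree U) (l : y.Leaf) :
    (node e y n).eltSet ((node e y n).path (Leaf.yes l)) = insert e (y.eltSet (y.path l)) := by
  simp only [eltSet, path, Finset.image_insert, Finset.map_eq_image, Finset.image_image, elt]
  rfl

lemma eltSet_path_no (e : U) (y n : DecTree U) (l : n.Leaf) :
    (node e y n).eltSet ((node e y n).path (Leaf.no l)) = insert e (n.eltSet (n.path l)) := by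
  simp only [eltSet, path, Finset.image_insert, Finset.map_eq_image, Finset.image_image, elt]
  rfl

lemma eltSet_active_yes (e : U) (y n : DecTree U) (l : y.Leaf) :
    (node e y n).eltSet ((node e y n).active (Leaf.yes l)) =
      insert e (y.eltSet (y.active l)) := by
  simp only [eltSet, active, Finset.image_insert, Finset.map_eq_image, Finset.image_image, elt]
  rfl

lemma eltSet_active_no (e : U) (y n : DecTree U) (l : n.Leaf) :
    (node e y n).eltSet ((node e y n).active (Leaf.no l)) = n.eltSet (n.active l) := by
  simp only [eltSet, active, Finset.map_eq_image, Finset.image_image]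
  rfl

lemma Distinct.notMem_yes {e : U} {y n : DecTree U} (h : (node e y n).Distinct) (l : y.Leaf) :
    e ∉ y.eltSet (y.path l) := by
  intro he
  obtain ⟨v, hv, hve⟩ := Finset.mem_image.1 he
  have := @h (Leaf.yes l) (Node.yes v) (Finset.mem_coe.2 (Finset.mem_insert_of_mem (Finset.mem_map_of_mem (yesNode e y n) hv)))
    Node.root (by simp [path]) hve
  cases this

lemma Distinct.notMem_no {e : U} {y n : DecTree U} (h : (node e y n).Distinct) (l : n.Leaf) :
    e ∉ n.eltSet (n.path l) := by
  intro he
  obtain ⟨v, hv, hve⟩ := Finset.mem_image.1 he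
  have := @h (Leaf.no l) (Node.no v) (Finset.mem_coe.2 (Finset.mem_insert_of_mem (Finset.mem_map_of_mem (noNode e y n) hv)))
    Node.root (by simp [path]) hve
  cases this

lemma eltSet_nodesOf_inter (T : DecTree U) (S : Finset U) (V : Finset T.Node) :
    T.eltSet (T.nodesOf S ∩ V) = S ∩ T.eltSet V := by
  ext e
  simp only [eltSet, nodesOf, Finset.mem_image, Finset.mem_inter, Finset.mem_filter,
    Finset.mem_univ, true_and]
  constructor
  · rintro ⟨v, ⟨h1, h2⟩, rfl⟩
    exact ⟨h1, v, h2, rfl⟩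
  · rintro ⟨h1, v, h2, rfl⟩
    exact ⟨v, ⟨h1, h2⟩, rfl⟩

lemma Distinct.card_eltSet {T : DecTree U} (hT : T.Distinct) {l : T.Leaf} {V : Finset T.Node}
    (hV : V ⊆ T.path l) : (T.eltSet V).card = V.card :=
  Finset.card_image_of_injOn ((hT l).mono (by exact_mod_cast hV))

variable [Fintype U]

/-- The weight of the set `J` when a leaf `l` is sampled with density `ω`, and each element of
`B l` is retained independently with probability `δ`. -/
def thinned (p : U → ℝ) (δ : ℝ) (T : DecTree U) (ω : T.Leaf → ℝ) (B : T.Leaf → Finset U)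
    (J : Finset U) : ℝ :=
  T.expLeaf p fun l => ω l * expSet (fun _ => δ) fun Z => if Z ∩ B l = J then 1 else 0

/-! ### The law of a sparse random subset of the set attached to a leaf. -/

section Thinned

variable {p : U → ℝ} {δ : ℝ} {T : DecTree U} {ω : T.Leaf → ℝ} {B : T.Leaf → Finset U}

lemma thinned_nonneg (hp : ∀ e, p e ∈ Set.Icc (0 : ℝ) 1) (hδ : δ ∈ Set.Icc (0 : ℝ) 1)
    (hω : ∀ l, 0 ≤ ω l) (J : Finset U) : 0 ≤ thinned p δ T ω B J :=
  expLeaf_nonneg hp fun l => mul_nonneg (hω l) <| expSet_nonneg (fun _ => hδ) fun Z => by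
    split_ifs <;> norm_num

lemma thinned_mono {ω' : T.Leaf → ℝ} (hp : ∀ e, p e ∈ Set.Icc (0 : ℝ) 1)
    (hδ : δ ∈ Set.Icc (0 : ℝ) 1) (h : ∀ l, ω l ≤ ω' l) (J : Finset U) :
    thinned p δ T ω B J ≤ thinned p δ T ω' B J :=
  expLeaf_mono hp fun l => mul_le_mul_of_nonneg_right (h l) <|
    expSet_nonneg (fun _ => hδ) fun Z => by split_ifs <;> norm_num

lemma thinned_eq_zero (J : Finset U) (h : ∀ l, ω l ≠ 0 → ¬ J ⊆ B l) :
    thinned p δ T ω B J = 0 := by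
  refine Eq.trans (congrArg (T.expLeaf p) (funext fun l => ?_)) (expLeaf_zero p T)
  by_cases hl : ω l = 0
  · rw [hl, zero_mul]
  · have h0 : ∀ Z : Finset U, (if Z ∩ B l = J then (1 : ℝ) else 0) = 0 := fun Z => by
      rw [if_neg]
      rintro rfl
      exact h l hl Finset.inter_subset_right
    simp only [h0, expSet_const, mul_zero]

lemma sum_thinned_mul (ψ : Finset U → ℝ) :
    ∑ J, thinned p δ T ω B J * ψ J =
      T.expLeaf p fun l => ω l * expSet (fun _ => δ) fun Z => ψ (Z ∩ B l) := by
  simp only [thinned, expLeaf, expSet, Finset.sum_mul, Finset.mul_sum]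
  rw [Finset.sum_comm]
  refine Finset.sum_congr rfl fun l _ => ?_
  rw [Finset.sum_comm]
  refine Finset.sum_congr rfl fun Z _ => ?_
  rw [Finset.sum_eq_single (Z ∩ B l)]
  · simp only [if_true]; ring
  · intro J _ hJ
    rw [if_neg hJ.symm]; ring
  · simp

lemma sum_thinned : ∑ J, thinned p δ T ω B J = T.expLeaf p ω := by
  have h := sum_thinned_mul (p := p) (δ := δ) (T := T) (ω := ω) (B := B) fun _ => 1
  simpa only [mul_one, expSet_const] using h

lemma sum_thinned_mul_card :
    ∑ J, thinned p δ T ω B J * (J.card : ℝ) =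
      δ * T.expLeaf p fun l => ω l * ((B l).card : ℝ) := by
  rw [sum_thinned_mul fun J => (J.card : ℝ), ← expLeaf_const_mul]
  congr 1
  funext l
  rw [expSet_card_inter]
  ring

end Thinned

end Tree

/-! ### The decoupling inequality. -/

section Entropy

/-- Splitting an atom can only increase entropy, because both parts have logarithm at most `log d`.
-/
lemma mul_log_sub_add_le {a d : ℝ} (ha : 0 ≤ a) (had : a ≤ d) :
    (d - a) * Real.log (d - a) + a * Real.log a ≤ d * Real.log d := by
  have key : ∀ {x : ℝ}, 0 ≤ x → x ≤ d → x * Real.log x ≤ x * Real.log d := by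
    intro x hx hxd
    rcases hx.eq_or_lt with rfl | hx
    · simp
    · exact mul_le_mul_of_nonneg_left (Real.log_le_log hx hxd) hx.le
  have h1 := key ha had
  have h2 := key (sub_nonneg.2 had) (by linarith)
  linarith

/-- Gibbs' inequality for a two-point space with weights `1 - p` and `p`, tilted by `ρ`. -/
lemma mul_log_mixture_le {p x y ρ : ℝ} (hp : p ∈ Set.Icc (0 : ℝ) 1) (hx : 0 ≤ x) (hy : 0 ≤ y)
    (hρ : 0 < ρ) (hs : 0 < 1 - p + p * ρ) :
    ((1 - p) * x + p * y) * Real.log ((1 - p) * x + p * y) ≤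
      (1 - p) * (x * Real.log x) + p * (y * Real.log y) - p * y * Real.log ρ +
        ((1 - p) * x + p * y) * Real.log (1 - p + p * ρ) := by
  have hq : 0 ≤ 1 - p := sub_nonneg.2 hp.2
  set s := 1 - p + p * ρ with hsdef
  set d := (1 - p) * x + p * y with hd
  -- Jensen for `t * log t` at the points `x` and `y / ρ`, with the tilted weights `(1 - p) / s` and
  -- `p * ρ / s`; their average is `d / s`.
  have hJ := Real.convexOn_mul_log.2 (show x ∈ Set.Ici (0 : ℝ) from hx)
    (show y / ρ ∈ Set.Ici (0 : ℝ) from div_nonneg hy hρ.le)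
    (div_nonneg hq hs.le) (div_nonneg (mul_nonneg hp.1 hρ.le) hs.le)
    (by rw [← add_div, div_self hs.ne'])
  simp only [smul_eq_mul] at hJ
  have e1 : (1 - p) / s * x + p * ρ / s * (y / ρ) = d / s := by
    rw [hd]; field_simp
  have e2 : y * Real.log (y / ρ) = y * Real.log y - y * Real.log ρ := by
    rcases hy.eq_or_lt with rfl | hy
    · simp
    · rw [Real.log_div hy.ne' hρ.ne']; ring
  have e3 : d * Real.log (d / s) = d * Real.log d - d * Real.log s := by
    have hd0 : 0 ≤ d := add_nonneg (mul_nonneg hq hx) (mul_nonneg hp.1 hy)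
    rcases hd0.eq_or_lt with h | h
    · rw [← h]; simp
    · rw [Real.log_div h.ne' hs.ne']; ring
  rw [e1] at hJ
  have h2 := mul_le_mul_of_nonneg_left hJ hs.le
  have e4 : s * (d / s * Real.log (d / s)) = d * Real.log (d / s) := by field_simp
  have e5 : s * ((1 - p) / s * (x * Real.log x) + p * ρ / s * (y / ρ * Real.log (y / ρ))) =
      (1 - p) * (x * Real.log x) + p * (y * Real.log (y / ρ)) := by field_simp
  rw [e4, e5, e2, e3] at h2
  linarith

/-- The pointwise inequality behind `sum_thinned_mul_log_le`. -/
lemma thinning_step {p δ x y m w v : ℝ} (hp : p ∈ Set.Icc (0 : ℝ) 1)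
    (hδ : δ ∈ Set.Icc (0 : ℝ) 1) (hx : 0 ≤ x) (hm : 0 ≤ m) (hmy : m ≤ y)
    (hw : 0 < w) (hwv : w ≤ v) :
    ((1 - p) * x + p * y - δ * (p * m)) * Real.log w + δ * (p * m) * Real.log v +
        δ * (((1 - p) * x + p * y - δ * (p * m)) *
            Real.log ((1 - p) * x + p * y - δ * (p * m)) +
          δ * (p * m) * Real.log (δ * (p * m))) ≤
      (1 - p) * (x * Real.log ((1 - p) * w + p * v)) +
        p * (y * Real.log ((1 - p) * w + p * v)) +
        δ * ((1 - p) * (x * Real.log x) + p * (y * Real.log y)) := by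
  have hy : 0 ≤ y := hm.trans hmy
  have hq : 0 ≤ 1 - p := sub_nonneg.2 hp.2
  have hρ1 : 1 ≤ v / w := (one_le_div hw).2 hwv
  set ρ := v / w with hρ
  have hv : v = w * ρ := by rw [hρ]; field_simp
  have hs1 : 1 ≤ 1 - p + p * ρ := by nlinarith [hp.1]
  have hs : 0 < 1 - p + p * ρ := by linarith
  have hρ0 : 0 < ρ := by linarith
  set d := (1 - p) * x + p * y with hd
  have hd0 : 0 ≤ d := add_nonneg (mul_nonneg hq hx) (mul_nonneg hp.1 hy)
  have hpm : 0 ≤ p * m := mul_nonneg hp.1 hm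
  have hpmy : p * m ≤ p * y := mul_le_mul_of_nonneg_left hmy hp.1
  have hqx : 0 ≤ (1 - p) * x := mul_nonneg hq hx
  have hδm : δ * (p * m) ≤ p * m := mul_le_of_le_one_left hpm hδ.2
  have h1 := mul_le_mul_of_nonneg_left
    (mul_log_sub_add_le (mul_nonneg hδ.1 hpm) (show δ * (p * m) ≤ d by linarith)) hδ.1
  have h2 := mul_le_mul_of_nonneg_left (mul_log_mixture_le hp hx hy hρ0 hs) hδ.1
  rw [← hd] at h2
  have hlogs : 0 ≤ Real.log (1 - p + p * ρ) := Real.log_nonneg hs1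
  have hlogρ : 0 ≤ Real.log ρ := Real.log_nonneg hρ1
  have ew : (1 - p) * w + p * v = w * (1 - p + p * ρ) := by rw [hv]; ring
  rw [ew, Real.log_mul hw.ne' hs.ne', hv, Real.log_mul hw.ne' hρ0.ne']
  -- Monotonicity of the weight (`w ≤ v`) enters here and in `h4`: both logarithms are nonnegative,
  -- so `m` may be raised to `y` and a factor `δ ≤ 1` dropped.
  have h3 : δ * (p * m) * Real.log ρ ≤ δ * (p * y) * Real.log ρ :=
    mul_le_mul_of_nonneg_right (mul_le_mul_of_nonneg_left hpmy hδ.1) hlogρ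
  have h4 : δ * (d * Real.log (1 - p + p * ρ)) ≤ d * Real.log (1 - p + p * ρ) :=
    mul_le_of_le_one_left (mul_nonneg hd0 hlogs) hδ.2
  have h5 : (1 - p) * (x * (Real.log w + Real.log (1 - p + p * ρ))) +
      p * (y * (Real.log w + Real.log (1 - p + p * ρ))) =
      d * Real.log w + d * Real.log (1 - p + p * ρ) := by rw [hd]; ring
  rw [h5]
  nlinarith

variable {U : Type} [Fintype U] [DecidableEq U]

lemma expSet_ite_inter_insert {δ : ℝ} {e : U} {B J : Finset U} (heB : e ∈ B) (heJ : e ∉ J) :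
    (expSet (fun _ => δ) fun Z => if Z ∩ B = J then (1 : ℝ) else 0) =
        (1 - δ) * expSet (fun _ => δ) (fun Z => if Z ∩ B.erase e = J then 1 else 0) ∧
      (expSet (fun _ => δ) fun Z => if Z ∩ B = insert e J then (1 : ℝ) else 0) =
        δ * expSet (fun _ => δ) (fun Z => if Z ∩ B.erase e = J then 1 else 0) := by
  have he := Finset.notMem_erase e B
  have hB := Finset.insert_erase heB
  constructor
  · have h := expSet_inter_insert (fun _ => δ) he fun S => if S = J then (1 : ℝ) else 0
    rw [hB] at h
    have h0 : ∀ S : Finset U, (if insert e S = J then (1 : ℝ) else 0) = 0 := fun S => by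
      rw [if_neg]
      rintro rfl
      exact heJ (Finset.mem_insert_self e S)
    simp only [h0, expSet_const, mul_zero, add_zero] at h
    exact h
  · have h := expSet_inter_insert (fun _ => δ) he fun S => if S = insert e J then (1 : ℝ) else 0
    rw [hB] at h
    have h0 : ∀ S : Finset U, (if S ∩ B.erase e = insert e J then (1 : ℝ) else 0) = 0 :=
      fun S => by
        rw [if_neg]
        intro hS
        exact he (Finset.mem_of_mem_inter_right (hS ▸ Finset.mem_insert_self e J))
    have h1 : ∀ S : Finset U, (if insert e (S ∩ B.erase e) = insert e J then (1 : ℝ) else 0) =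
        if S ∩ B.erase e = J then 1 else 0 := fun S => by
      have hS : e ∉ S ∩ B.erase e := fun h => he (Finset.mem_of_mem_inter_right h)
      congr 1
      rw [eq_iff_iff]
      refine ⟨fun h => ?_, fun h => by rw [h]⟩
      rw [← Finset.erase_insert hS, h, Finset.erase_insert heJ]
    simp only [h0, h1, expSet_const, mul_zero, zero_add] at h
    exact h

section Node

variable {p : U → ℝ} {δ : ℝ} {e : U} {y n : DecTree U} {ω : (node e y n).Leaf → ℝ}
  {B : (node e y n).Leaf → Finset U} {J : Finset U}

/-- Forgetting `e` merges the atoms `J` and `insert e J` of the Yes branch; the subtracted term is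
the mass that had retained `e`. -/
lemma thinned_node_of_notMem (heJ : e ∉ J) :
    thinned p δ (node e y n) ω B J =
      (1 - p e) * thinned p δ n (fun l => ω (Leaf.no l)) (fun l => B (Leaf.no l)) J +
        p e * thinned p δ y (fun l => ω (Leaf.yes l)) (fun l => (B (Leaf.yes l)).erase e) J -
        δ * (p e * thinned p δ y (fun l => if e ∈ B (Leaf.yes l) then ω (Leaf.yes l) else 0)
          (fun l => (B (Leaf.yes l)).erase e) J) := by
  have key : thinned p δ y (fun l => ω (Leaf.yes l)) (fun l => B (Leaf.yes l)) J =
      thinned p δ y (fun l => ω (Leaf.yes l)) (fun l => (B (Leaf.yes l)).erase e) J -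
        δ * thinned p δ y (fun l => if e ∈ B (Leaf.yes l) then ω (Leaf.yes l) else 0)
          (fun l => (B (Leaf.yes l)).erase e) J := by
    rw [thinned, thinned, thinned, ← expLeaf_const_mul, eq_sub_iff_add_eq, ← expLeaf_add]
    congr 1
    funext l
    by_cases he : e ∈ B (Leaf.yes l)
    · rw [if_pos he, (expSet_ite_inter_insert he heJ).1]
      ring
    · rw [if_neg he, Finset.erase_eq_of_notMem he]
      ring
  rw [thinned, expLeaf_node]
  change p e * thinned p δ y (fun l => ω (Leaf.yes l)) (fun l => B (Leaf.yes l)) J +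
    (1 - p e) * thinned p δ n (fun l => ω (Leaf.no l)) (fun l => B (Leaf.no l)) J = _
  rw [key]
  ring

/-- Only leaves below the Yes arc whose set contains `e` can produce `e`, and they retain it with
probability `δ`. -/
lemma thinned_node_insert (heJ : e ∉ J) (hB : ∀ l : n.Leaf, e ∉ B (Leaf.no l)) :
    thinned p δ (node e y n) ω B (insert e J) =
      δ * (p e * thinned p δ y (fun l => if e ∈ B (Leaf.yes l) then ω (Leaf.yes l) else 0)
          (fun l => (B (Leaf.yes l)).erase e) J) := by
  have key : thinned p δ y (fun l => ω (Leaf.yes l)) (fun l => B (Leaf.yes l)) (insert e J) =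
        δ * thinned p δ y (fun l => if e ∈ B (Leaf.yes l) then ω (Leaf.yes l) else 0)
          (fun l => (B (Leaf.yes l)).erase e) J := by
    rw [thinned, thinned, ← expLeaf_const_mul]
    congr 1
    funext l
    by_cases he : e ∈ B (Leaf.yes l)
    · rw [if_pos he, (expSet_ite_inter_insert he heJ).2]
      ring
    · have h0 : ∀ Z : Finset U, (if Z ∩ B (Leaf.yes l) = insert e J then (1 : ℝ) else 0) = 0 :=
        fun Z => by
          rw [if_neg]
          intro hZ
          exact he (Finset.mem_of_mem_inter_right (hZ ▸ Finset.mem_insert_self e J))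
      simp only [if_neg he, h0, expSet_const, mul_zero, zero_mul]
  rw [thinned, expLeaf_node]
  change p e * thinned p δ y (fun l => ω (Leaf.yes l)) (fun l => B (Leaf.yes l)) (insert e J) +
    (1 - p e) * thinned p δ n (fun l => ω (Leaf.no l)) (fun l => B (Leaf.no l)) (insert e J) = _
  rw [key, thinned_eq_zero (T := n)]
  · ring
  · exact fun l _ h => hB l (h (Finset.mem_insert_self e J))

end Node

/-- A decoupling inequality. Sample a leaf `l` with density `ω` and retain each element of
`B l`, a set of active elements of its path, with probability `δ`. The resulting law is compared,
up to `δ` times its entropy, with the law of the active elements on a path that is independent of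
the realization. -/
theorem sum_thinned_mul_log_le {p : U → ℝ} (hp : ∀ e, p e ∈ Set.Icc (0 : ℝ) 1) {δ : ℝ}
    (hδ : δ ∈ Set.Icc (0 : ℝ) 1) (T : DecTree U) (hT : T.Distinct) (ω : T.Leaf → ℝ)
    (hω : ∀ l, ω l ∈ Set.Icc (0 : ℝ) 1) (B : T.Leaf → Finset U)
    (hB : ∀ l, B l ⊆ T.eltSet (T.active l)) (w : Finset U → ℝ) (hw : ∀ S, 0 < w S)
    (hmono : Monotone w) :
    ∑ J, (thinned p δ T ω B J * Real.log (w J) +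
        δ * (thinned p δ T ω B J * Real.log (thinned p δ T ω B J))) ≤
      (T.expLeaf p fun l => ω l * expSet p fun S => w (S ∩ T.eltSet (T.path l))) -
        T.expLeaf p ω := by
  induction T generalizing w with
  | leaf =>
    have hB0 : B Leaf.here = ∅ := by simpa [active, eltSet] using hB Leaf.here
    have hP0 : (leaf : DecTree U).eltSet (path leaf Leaf.here) = ∅ := by simp [path, eltSet]
    have hD : ∀ J, thinned p δ leaf ω B J = if J = ∅ then ω Leaf.here else 0 := by
      intro J
      simp only [thinned, expLeaf_leaf, hB0, Finset.inter_empty, expSet_const, eq_comm (a := J)]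
      split_ifs <;> simp
    rw [Finset.sum_eq_single ∅ (fun J _ hJ => by rw [hD, if_neg hJ]; simp) (by simp)]
    simp only [hD, if_true, expLeaf_leaf, hP0, Finset.inter_empty, expSet_const]
    -- At a leaf, `log w ≤ w - 1` suffices, because `ω ≤ 1` makes the entropy term nonpositive.
    have h1 := Real.log_le_sub_one_of_pos (hw ∅)
    have h2 := Real.log_nonpos (hω Leaf.here).1 (hω Leaf.here).2
    have h3 := mul_le_mul_of_nonneg_left h1 (hω Leaf.here).1
    have h4 := mul_nonpos_of_nonneg_of_nonpos hδ.1
      (mul_nonpos_of_nonneg_of_nonpos (hω Leaf.here).1 h2)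
    linarith
  | node e y n ihy ihn =>
    have hBn : ∀ l : n.Leaf, B (Leaf.no l) ⊆ n.eltSet (n.active l) := fun l => by
      rw [← eltSet_active_no e y n]; exact hB _
    have hBy : ∀ l : y.Leaf, (B (Leaf.yes l)).erase e ⊆ y.eltSet (y.active l) := fun l => by
      rw [← Finset.subset_insert_iff, ← eltSet_active_yes e y n]; exact hB _
    have heBn : ∀ l : n.Leaf, e ∉ B (Leaf.no l) := fun l h =>
      hT.notMem_no l (Finset.image_subset_image (active_subset_path n l) (hBn l h))
    -- Averaging out the fresh realization of `e` gives one test function for both subtrees: `e` is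
    -- probed whichever arc is taken.
    set w' : Finset U → ℝ := fun S => (1 - p e) * w S + p e * w (insert e S) with hw'
    have hq : 0 ≤ 1 - p e := sub_nonneg.2 (hp e).2
    have hle : ∀ S, w S ≤ w (insert e S) := fun S => hmono (Finset.subset_insert e S)
    have hw'pos : ∀ S, 0 < w' S := fun S => by
      have := hw S
      have := mul_le_mul_of_nonneg_left (hle S) (hp e).1
      simp only [hw']
      linarith
    have hw'mono : Monotone w' := fun S S' h => by
      have h1 := mul_le_mul_of_nonneg_left (hmono h) hq
      have h2 := mul_le_mul_of_nonneg_left (hmono (Finset.insert_subset_insert e h)) (hp e).1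
      simp only [hw']
      linarith
    have hy := ihy hT.yes (fun l => ω (Leaf.yes l)) (fun l => hω _)
      (fun l => (B (Leaf.yes l)).erase e) hBy w' hw'pos hw'mono
    have hn := ihn hT.no (fun l => ω (Leaf.no l)) (fun l => hω _)
      (fun l => B (Leaf.no l)) hBn w' hw'pos hw'mono
    have hG : (expLeaf p (node e y n) fun l => ω l * expSet p fun S =>
        w (S ∩ (node e y n).eltSet ((node e y n).path l))) =
        p e * (y.expLeaf p fun l => ω (Leaf.yes l) *
          expSet p fun S => w' (S ∩ y.eltSet (y.path l))) +
        (1 - p e) * (n.expLeaf p fun l => ω (Leaf.no l) *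
          expSet p fun S => w' (S ∩ n.eltSet (n.path l))) := by
      rw [expLeaf_node]
      congr 3
      · funext l
        rw [eltSet_path_yes, expSet_inter_insert p (hT.notMem_yes l), ← expSet_const_mul,
          ← expSet_const_mul, ← expSet_add]
      · funext l
        rw [eltSet_path_no, expSet_inter_insert p (hT.notMem_no l), ← expSet_const_mul,
          ← expSet_const_mul, ← expSet_add]
    rw [hG, expLeaf_node p e y n ω]
    have hy' := mul_le_mul_of_nonneg_left hy (hp e).1
    have hn' := mul_le_mul_of_nonneg_left hn hq
    refine le_trans ?_ (le_trans (add_le_add hy' hn') (le_of_eq (by ring)))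
    -- Pairing `J` with `insert e J` reduces the claim to `thinning_step` for each `J` avoiding `e`.
    rw [sum_finset_eq_sum_erase e, sum_finset_eq_sum_erase e, sum_finset_eq_sum_erase e,
      Finset.mul_sum, Finset.mul_sum, ← Finset.sum_add_distrib]
    refine Finset.sum_le_sum fun J hJ => ?_
    have heJ : e ∉ J := fun h => Finset.notMem_erase e _ (Finset.mem_powerset.1 hJ h)
    rw [thinned_node_of_notMem heJ, thinned_node_insert heJ heBn,
      thinned_eq_zero (T := n) (insert e J) fun l _ h =>
        heBn l (h (Finset.mem_insert_self e J)),
      thinned_eq_zero (T := y) (insert e J) fun l _ h =>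
        Finset.notMem_erase e _ (h (Finset.mem_insert_self e J))]
    have hstep := thinning_step (hp e) hδ
      (thinned_nonneg (T := n) (B := fun l => B (Leaf.no l)) hp hδ (fun l => (hω (Leaf.no l)).1) J)
      (thinned_nonneg (T := y) (B := fun l => (B (Leaf.yes l)).erase e)
        (ω := fun l => if e ∈ B (Leaf.yes l) then ω (Leaf.yes l) else 0) hp hδ
        (fun l => by split_ifs; exacts [(hω _).1, le_rfl]) J)
      (thinned_mono (T := y) (B := fun l => (B (Leaf.yes l)).erase e)
        (ω' := fun l => ω (Leaf.yes l)) hp hδ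
        (fun l => by split_ifs; exacts [le_rfl, (hω _).1]) J)
      (hw J) (hle J)
    simp only [hw', zero_mul, mul_zero, add_zero] at hstep ⊢
    linarith

end Entropy

/-! ### Entropy of sparse sets, and the bound for one dyadic class. -/

section Gap

lemma neg_mul_log_le {x μ : ℝ} (hx : 0 ≤ x) (hμ : 0 < μ) :
    -(x * Real.log x) ≤ -(x * Real.log μ) + μ - x := by
  rcases hx.eq_or_lt with rfl | hx
  · simpa using hμ.le
  · have h := mul_le_mul_of_nonneg_left (Real.log_le_sub_one_of_pos (div_pos hμ hx)) hx.le
    rw [Real.log_div hμ.ne' hx.ne'] at h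
    have e : x * (μ / x - 1) = μ - x := by field_simp
    linarith

variable {U : Type}

section Fxos

variable [DecidableEq U]

lemma fxos_mono (T : DecTree U) (A : T.Leaf → Finset T.Node) : Monotone (T.fxos A) :=
  fun _ _ h => Finset.sup_mono_fun fun _ _ =>
    Finset.card_le_card (Finset.inter_subset_inter_left h)

lemma card_le_fxos {T : DecTree U} {A : T.Leaf → Finset T.Node} {J : Finset U} {l : T.Leaf}
    (h : J ⊆ T.eltSet (A l)) : J.card ≤ T.fxos A J := by
  refine le_trans (le_of_eq ?_) (Finset.le_sup (Finset.mem_univ l))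
  rw [Finset.inter_eq_right.2 h]

end Fxos

variable [Fintype U]

/-- The entropy of a random set is at most its expected size times the logarithm of the size of
the ground set, up to lower order terms. -/
lemma entropy_le [Nonempty U] {D : Finset U → ℝ} (hD : ∀ J, 0 ≤ D J) (hpos : 0 < ∑ J, D J) :
    -∑ J, D J * Real.log (D J) ≤
      (∑ J, D J * (J.card : ℝ)) * Real.log (Fintype.card U) +
        (∑ J, D J) * (1 - Real.log (∑ J, D J)) := by
  set Z := ∑ J, D J with hZ
  have hn : (0 : ℝ) < Fintype.card U := by exact_mod_cast Fintype.card_pos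
  set N : ℝ := (Fintype.card U : ℝ) with hN
  -- Reference measure for Gibbs' inequality: each element costs `log N`, and `(1 + 1 / N) ^ N ≤ e`
  -- bounds the total mass.
  have hμ : ∑ J : Finset U, Z * Real.exp (-1) * N⁻¹ ^ J.card ≤ Z := by
    rw [← Finset.mul_sum]
    have h1 : ∑ J : Finset U, N⁻¹ ^ J.card = (N⁻¹ + 1) ^ Fintype.card U := by
      simpa using Fintype.sum_pow_mul_eq_add_pow U N⁻¹ (1 : ℝ)
    have h2 : (N⁻¹ + 1) ^ Fintype.card U ≤ Real.exp 1 := by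
      calc (N⁻¹ + 1) ^ Fintype.card U ≤ Real.exp N⁻¹ ^ Fintype.card U :=
            pow_le_pow_left₀ (by positivity) (Real.add_one_le_exp _) _
        _ = Real.exp 1 := by
            rw [← Real.exp_nat_mul, ← hN, mul_inv_cancel₀ hn.ne']
    rw [h1]
    calc Z * Real.exp (-1) * (N⁻¹ + 1) ^ Fintype.card U ≤ Z * Real.exp (-1) * Real.exp 1 := by
          gcongr
      _ = Z := by rw [mul_assoc, ← Real.exp_add]; simp
  have hterm : ∀ J : Finset U, -(D J * Real.log (D J)) ≤
      D J * (J.card : ℝ) * Real.log N + D J * (1 - Real.log Z) +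
        (Z * Real.exp (-1) * N⁻¹ ^ J.card - D J) := by
    intro J
    have hm : 0 < Z * Real.exp (-1) * N⁻¹ ^ J.card := by positivity
    refine (neg_mul_log_le (hD J) hm).trans (le_of_eq ?_)
    rw [Real.log_mul (by positivity) (by positivity), Real.log_mul hpos.ne' (by positivity),
      Real.log_exp, Real.log_pow, Real.log_inv]
    ring
  calc -∑ J, D J * Real.log (D J) = ∑ J, -(D J * Real.log (D J)) := by
        rw [Finset.sum_neg_distrib]
    _ ≤ ∑ J, (D J * (J.card : ℝ) * Real.log N + D J * (1 - Real.log Z) +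
        (Z * Real.exp (-1) * N⁻¹ ^ J.card - D J)) := Finset.sum_le_sum fun J _ => hterm J
    _ ≤ _ := by
        rw [Finset.sum_add_distrib, Finset.sum_add_distrib, Finset.sum_sub_distrib,
          ← Finset.sum_mul, ← Finset.sum_mul]
        linarith

variable [DecidableEq U]

lemma expSet_exp_fxos_le {p : U → ℝ} (hp : ∀ e, p e ∈ Set.Icc (0 : ℝ) 1) (T : DecTree U)
    (A : T.Leaf → Finset T.Node) (P : Finset U) :
    expSet p (fun S => Real.exp ((T.fxos A (S ∩ P) : ℝ) / 2)) ≤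
      Real.exp (expSet p fun S => (T.fxos A (S ∩ P) : ℝ)) := by
  refine le_trans (expSet_mono hp fun S => ?_) <|
    (expSet_exp_sup_le hp (fun l => T.eltSet (A l)) P fun _ => 0).trans <|
      Real.exp_le_exp.2 <| expSet_mono hp fun S => ?_
  · refine Real.exp_le_exp.2 ?_
    obtain ⟨l, hl, h⟩ := Finset.exists_mem_eq_sup Finset.univ Finset.univ_nonempty
      fun l : T.Leaf => (T.eltSet (A l) ∩ (S ∩ P)).card
    rw [fxos, h]
    exact (zero_add (_ : ℝ)).symm.le.trans <|
      Finset.le_sup' (fun l => (0 : ℝ) + ((T.eltSet (A l) ∩ (S ∩ P)).card : ℝ) / 2) hl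
  · refine Finset.sup'_le _ _ fun l hl => ?_
    rw [zero_add]
    exact_mod_cast Finset.le_sup (f := fun l : T.Leaf => (T.eltSet (A l) ∩ (S ∩ P)).card) hl

/-- The expected reward of probing all elements of the path of the leaf `l`. -/
def pathReward (p : U → ℝ) (T : DecTree U) (A : T.Leaf → Finset T.Node) (l : T.Leaf) : ℝ :=
  expSet p fun S => (T.fxos A (S ∩ T.eltSet (T.path l)) : ℝ)

lemma nadp_fxos (p : U → ℝ) (T : DecTree U) (A : T.Leaf → Finset T.Node) :
    T.nadp p (fun S => (T.fxos A S : ℝ)) = T.expLeaf p (pathReward p T A) := by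
  simp only [nadp, expR, eltSet_nodesOf_inter]
  rfl

/-- If the leaves in the support of the density `ω` have small reward, then the expected size of
`A l` is controlled by the entropy of a random sparse subset of `A l`. -/
lemma card_le_of_pathReward_le [Nonempty U] {p : U → ℝ} (hp : ∀ e, p e ∈ Set.Icc (0 : ℝ) 1)
    {δ : ℝ} (hδ : δ ∈ Set.Icc (0 : ℝ) 1) {T : DecTree U} (hT : T.Distinct)
    {A : T.Leaf → Finset T.Node} (hA : ∀ l, A l ⊆ T.active l) {ω : T.Leaf → ℝ}
    (hω : ∀ l, ω l ∈ Set.Icc (0 : ℝ) 1) (hpos : 0 < T.expLeaf p ω) {τ : ℝ}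
    (hτ : ∀ l, ω l ≠ 0 → pathReward p T A l ≤ τ) :
    δ * (T.expLeaf p fun l => ω l * ((A l).card : ℝ)) / 2 - τ * T.expLeaf p ω ≤
      δ * (δ * (T.expLeaf p fun l => ω l * ((A l).card : ℝ)) * Real.log (Fintype.card U) +
        T.expLeaf p ω * (1 - Real.log (T.expLeaf p ω))) := by
  set B : T.Leaf → Finset U := fun l => T.eltSet (A l) with hBdef
  set D := thinned p δ T ω B with hDdef
  have hD0 : ∀ J, 0 ≤ D J := thinned_nonneg hp hδ fun l => (hω l).1
  have hsum : ∑ J, D J = T.expLeaf p ω := sum_thinned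
  have hcard : ∑ J, D J * (J.card : ℝ) = δ * T.expLeaf p fun l => ω l * ((A l).card : ℝ) := by
    rw [hDdef, sum_thinned_mul_card]
    simp only [hBdef, hT.card_eltSet ((hA _).trans (active_subset_path T _))]
  have hmain := sum_thinned_mul_log_le hp hδ T hT ω hω B
    (fun l => Finset.image_subset_image (hA l))
    (fun S => Real.exp ((T.fxos A S : ℝ) / 2 - τ)) (fun S => Real.exp_pos _)
    (fun S S' h => Real.exp_le_exp.2 (by
      have : (T.fxos A S : ℝ) ≤ T.fxos A S' := by exact_mod_cast fxos_mono T A h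
      linarith))
  -- The shift by `τ` normalizes the test function: on the support of `ω` its fresh expectation is
  -- at most 1, so the right side of `hmain` is at most 0.
  have hG : (T.expLeaf p fun l => ω l * expSet p fun S =>
      Real.exp ((T.fxos A (S ∩ T.eltSet (T.path l)) : ℝ) / 2 - τ)) ≤ T.expLeaf p ω := by
    refine expLeaf_mono hp fun l => ?_
    by_cases hl : ω l = 0
    · rw [hl, zero_mul]
    refine mul_le_of_le_one_right (hω l).1 ?_
    have h1 := expSet_exp_fxos_le hp T A (T.eltSet (T.path l))
    calc _ = Real.exp (-τ) * expSet p fun S =>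
          Real.exp ((T.fxos A (S ∩ T.eltSet (T.path l)) : ℝ) / 2) := by
          rw [← expSet_const_mul]
          simp only [← Real.exp_add, sub_eq_neg_add]
      _ ≤ Real.exp (-τ) * Real.exp τ := by
          gcongr
          exact h1.trans (Real.exp_le_exp.2 (hτ l hl))
      _ = 1 := by rw [← Real.exp_add]; simp
  have hent := entropy_le hD0 (by rwa [hsum])
  rw [hsum, hcard] at hent
  have hlow : ∀ J, D J * (J.card : ℝ) * (1 / 2) - D J * τ ≤
      D J * Real.log (Real.exp ((T.fxos A J : ℝ) / 2 - τ)) := by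
    intro J
    rw [Real.log_exp]
    by_cases h : ∃ l, ω l ≠ 0 ∧ J ⊆ B l
    · obtain ⟨l, -, hl⟩ := h
      have h1 : (J.card : ℝ) ≤ T.fxos A J := by exact_mod_cast card_le_fxos hl
      have h2 := mul_le_mul_of_nonneg_left h1 (hD0 J)
      linarith
    · push Not at h
      have : D J = 0 := thinned_eq_zero J h
      rw [this]; simp
  have hlow' := Finset.sum_le_sum fun J (_ : J ∈ Finset.univ) => hlow J
  rw [Finset.sum_sub_distrib, ← Finset.sum_mul, ← Finset.sum_mul, hcard, hsum] at hlow'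
  rw [Finset.sum_add_distrib, ← Finset.mul_sum] at hmain
  have := mul_le_mul_of_nonneg_left hent hδ.1
  linarith

/-- Leaves with `k ≤ |A l| ≤ 2 k` and small reward contribute at most a constant to the expected
size of `A l`. -/
lemma card_le_of_dyadic {n : ℕ} (hn : 2 ≤ n) {p : Fin n → ℝ}
    (hp : ∀ e, p e ∈ Set.Icc (0 : ℝ) 1) {T : DecTree (Fin n)} (hT : T.Distinct)
    {A : T.Leaf → Finset T.Node} (hA : ∀ l, A l ⊆ T.active l) {ω : T.Leaf → ℝ}
    (hω : ∀ l, ω l ∈ Set.Icc (0 : ℝ) 1) {k : ℝ}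
    (hk : ∀ l, ω l ≠ 0 → k ≤ (A l).card ∧ ((A l).card : ℝ) ≤ 2 * k)
    (hr : ∀ l, ω l ≠ 0 → pathReward p T A l ≤ k / (50 * Real.logb 2 n)) :
    (T.expLeaf p fun l => ω l * ((A l).card : ℝ)) ≤ 9 := by
  have : Nonempty (Fin n) := ⟨⟨0, by omega⟩⟩
  have hn' : (2 : ℝ) ≤ n := by exact_mod_cast hn
  have hL : 1 ≤ Real.logb 2 n := by
    rw [Real.le_logb_iff_rpow_le (by norm_num) (by linarith)]
    simpa using hn'
  have hlog : Real.log n = Real.logb 2 n * Real.log 2 := by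
    rw [Real.logb, div_mul_cancel₀ _ (Real.log_pos (by norm_num)).ne']
  set L := Real.logb 2 n with hLdef
  set X := T.expLeaf p fun l => ω l * ((A l).card : ℝ) with hX
  set Z := T.expLeaf p ω with hZ
  have hX1 : k * Z ≤ X := by
    rw [hX, hZ, ← expLeaf_const_mul]
    refine expLeaf_mono hp fun l => ?_
    by_cases hl : ω l = 0
    · simp [hl]
    · rw [mul_comm]; exact mul_le_mul_of_nonneg_left (hk l hl).1 (hω l).1
  have hX2 : X ≤ 2 * k * Z := by
    rw [hX, hZ, ← expLeaf_const_mul]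
    refine expLeaf_mono hp fun l => ?_
    by_cases hl : ω l = 0
    · simp [hl]
    · rw [mul_comm (2 * k)]; exact mul_le_mul_of_nonneg_left (hk l hl).2 (hω l).1
  have hZ0 : 0 ≤ Z := expLeaf_nonneg hp fun l => (hω l).1
  rcases hZ0.eq_or_lt with h0 | hZpos
  · rw [← h0] at hX2; linarith
  have hL0 : 0 < L := by linarith
  -- With this rate the entropy contributes `X * log 2 / 4` after scaling by `4 * L`, against `X /
  -- 2` on the left.
  have hδ : 1 / (4 * L) ∈ Set.Icc (0 : ℝ) 1 :=
    ⟨by positivity, by rw [div_le_one (by positivity)]; linarith⟩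
  have h := card_le_of_pathReward_le hp hδ hT hA hω hZpos hr
  rw [Fintype.card_fin, hlog] at h
  have h' := mul_le_mul_of_nonneg_left h (show 0 ≤ 4 * L by positivity)
  have e1 : 4 * L * (1 / (4 * L) * X / 2 - k / (50 * L) * Z) = X / 2 - 4 / 50 * (k * Z) := by
    field_simp
  have e2 : 4 * L * (1 / (4 * L) * (1 / (4 * L) * X * (L * Real.log 2) +
      Z * (1 - Real.log Z))) = X * Real.log 2 / 4 + Z * (1 - Real.log Z) := by
    field_simp
  rw [← hX, ← hZ, e1, e2] at h'
  have hZlog : Z * (1 - Real.log Z) ≤ 1 := by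
    have := neg_mul_log_le hZ0 one_pos
    simp only [Real.log_one] at this
    linarith
  have hX0 : 0 ≤ X := expLeaf_nonneg hp fun l => mul_nonneg (hω l).1 (Nat.cast_nonneg _)
  -- Since `k * Z ≤ X`, the coefficient of `X` left over is `1 / 2 - 4 / 50 - (log 2) / 4 > 0.24`,
  -- against at most 1 on the right.
  have := mul_le_mul_of_nonneg_left Real.log_two_lt_d9.le hX0
  linarith

end Gap

end DecTree

/-! ### Summation over the dyadic classes. -/

open DecTree in
theorem mainTheorem7 (n : ℕ) (hn : 100 ≤ n)
    (p : Fin n → ℝ) (hp : ∀ e, p e ∈ Set.Icc (0 : ℝ) 1)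
    (T : DecTree (Fin n)) (hT : T.Distinct)
    (A' : T.Leaf → Finset T.Node) (hA' : ∀ l, A' l ⊆ T.active l)
    (hE : 200 * Real.logb 2 n ≤ T.expLeaf p fun l => ((A' l).card : ℝ)) :
    (1 / (200 * Real.logb 2 n)) * (T.expLeaf p fun l => ((A' l).card : ℝ)) ≤
      T.nadp p fun S => (T.fxos A' S : ℝ) := by
  have hn2 : (2 : ℝ) ≤ n := by exact_mod_cast (by omega : 2 ≤ n)
  have hL : 1 ≤ Real.logb 2 n := by
    rw [Real.le_logb_iff_rpow_le (by norm_num) (by linarith)]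
    simpa using hn2
  have hnat : (Nat.log 2 n : ℝ) ≤ Real.logb 2 n := by exact_mod_cast Real.natLog_le_logb n 2
  set L := Real.logb 2 n with hLdef
  have hL0 : 0 < L := by linarith
  set M := T.expLeaf p fun l => ((A' l).card : ℝ) with hM
  have hcard : ∀ l, (A' l).card ≤ n := fun l => by
    rw [← hT.card_eltSet ((hA' l).trans (active_subset_path T l))]
    simpa using Finset.card_le_univ (T.eltSet (A' l))
  -- Indicators of the bad leaves in each dyadic class. Empty sets are excluded because `Nat.log 2 0
  -- = 0` would put them into class 0, where the size must be at least 1.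
  set ω : ℕ → T.Leaf → ℝ := fun i l =>
    if (A' l).card ≠ 0 ∧ Nat.log 2 (A' l).card = i ∧
      pathReward p T A' l ≤ (A' l).card / (100 * L) then 1 else 0 with hω
  have hω1 : ∀ i l, ω i l ∈ Set.Icc (0 : ℝ) 1 := fun i l => by
    simp only [hω]
    split_ifs <;> simp
  have hdyadic : ∀ i, (T.expLeaf p fun l => ω i l * ((A' l).card : ℝ)) ≤ 9 := by
    intro i
    have hsupp : ∀ l, ω i l ≠ 0 → (2 : ℝ) ^ i ≤ (A' l).card ∧
        ((A' l).card : ℝ) ≤ 2 * 2 ^ i ∧ pathReward p T A' l ≤ (A' l).card / (100 * L) := by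
      intro l hl
      simp only [hω, ne_eq, ite_eq_right_iff, one_ne_zero, imp_false, not_not] at hl
      obtain ⟨h0, rfl, hr⟩ := hl
      refine ⟨by exact_mod_cast Nat.pow_log_le_self 2 h0, ?_, hr⟩
      have := Nat.lt_pow_succ_log_self one_lt_two (A' l).card
      rw [pow_succ'] at this
      exact_mod_cast this.le
    refine card_le_of_dyadic (by omega) hp hT hA' (hω1 i) (k := 2 ^ i)
      (fun l hl => ⟨(hsupp l hl).1, (hsupp l hl).2.1⟩) fun l hl => ?_
    refine (hsupp l hl).2.2.trans ?_
    -- The size is at most `2 * 2 ^ i`, which turns the constant 100 into 50.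
    rw [div_le_div_iff₀ (by positivity) (by positivity)]
    nlinarith [(hsupp l hl).2.1]
  have hpoint : ∀ l, ((A' l).card : ℝ) ≤ 100 * L * pathReward p T A' l +
      ∑ i ∈ Finset.range (Nat.log 2 n + 1), ω i l * ((A' l).card : ℝ) := by
    intro l
    have hr0 : 0 ≤ pathReward p T A' l := expSet_nonneg hp fun S => Nat.cast_nonneg _
    have hterm : ∀ i, 0 ≤ ω i l * ((A' l).card : ℝ) := fun i =>
      mul_nonneg (hω1 i l).1 (Nat.cast_nonneg _)
    by_cases hr : pathReward p T A' l ≤ (A' l).card / (100 * L)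
    · by_cases h0 : (A' l).card = 0
      · have := Finset.sum_nonneg fun i (_ : i ∈ Finset.range (Nat.log 2 n + 1)) => hterm i
        have h00 : ((A' l).card : ℝ) = 0 := by exact_mod_cast h0
        have : 0 ≤ 100 * L * pathReward p T A' l := by positivity
        linarith
      · have hmem : Nat.log 2 (A' l).card ∈ Finset.range (Nat.log 2 n + 1) :=
          Finset.mem_range.2 (Nat.lt_succ_of_le (Nat.log_mono_right (hcard l)))
        have h1 := Finset.single_le_sum (fun i _ => hterm i) hmem
        have h2 : ω (Nat.log 2 (A' l).card) l = 1 := if_pos ⟨h0, rfl, hr⟩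
        rw [h2, one_mul] at h1
        have : 0 ≤ 100 * L * pathReward p T A' l := by positivity
        linarith
    · have := Finset.sum_nonneg fun i (_ : i ∈ Finset.range (Nat.log 2 n + 1)) => hterm i
      push Not at hr
      rw [div_lt_iff₀ (by positivity)] at hr
      linarith
  have htotal := expLeaf_mono hp hpoint
  rw [expLeaf_add, expLeaf_const_mul, expLeaf_sum, ← hM] at htotal
  have hsum := Finset.sum_le_sum fun i (_ : i ∈ Finset.range (Nat.log 2 n + 1)) => hdyadic i
  rw [Finset.sum_const, Finset.card_range, nsmul_eq_mul] at hsum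
  push_cast at hsum
  rw [nadp_fxos, one_div, inv_mul_le_iff₀ (by positivity)]
  -- The bad part is at most `9 * (L + 1) ≤ 18 * L ≤ M / 2`, so `M / 2` is at most `100 * L` times
  -- the reward.
  linarith
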